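/- Fix countably infinite supplies of atomic propositions and of trace variables. HyperLTL formulas are given by $\psi ::= \exists\pi.\,\psi \mid \forall\pi.\,\psi \mid \varphi$ and $\varphi ::= a_\pi \mid \neg\varphi \mid \varphi\vee\varphi \mid \bigcirc\varphi \mid \varphi\,\mathcal U\,\varphi$, with the usual semantics over sets $T$ of infinite traces; formulas are coded effectively by natural numbers. For every formula $\varphi$ let $\mathrm{AP}_\varphi$ be any set of atomic propositions containing those that occur in $\varphi$ (for instance exactly those, or all of them), let $\Sigma=2^{\mathrm{AP}_\varphi}$, and for a closed formula $\varphi$ let $\mathcal L(\varphi)\subseteq\mathcal P(\Sigma^\omega)$ be the set of all $T\subseteq\Sigma^\omega$ that satisfy $\varphi$. For $U\subseteq\Sigma^*$ and $T\subseteq\Sigma^\omega$ write $U\le T$ if every $u\in U$ is a prefix of some $t\in T$. A set $U\subseteq\Sigma^*$ is a bad prefix for a hyperproperty $S\subseteq\mathcal P(\Sigma^\omega)$ if no $T$ with $U\le T$ belongs to $S$. $S$ is a safety hyperproperty if every $T\notin S$ has a finite bad prefix $U\le T$; it is a $k$-safety hyperproperty if, moreover, every $T\notin S$ has a bad prefix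 $U\le T$ with $|U|\le k$. Then there is no algorithm that, given a closed HyperLTL formula $\varphi$, decides 1. for a fixed $k\in\mathbb N$ (whichever $k$ is fixed), whether $\mathcal L(\varphi)$ is a $k$-safety hyperproperty; 2. whether $\mathcal L(\varphi)$ is a $k$-safety hyperproperty for some $k\in\mathbb N$; 3. whether $\mathcal L(\varphi)$ is a safety hyperproperty; 4. whether $\mathcal L(\varphi)$ is a safety hyperproperty in the variant sense in which the bad prefix $U\le T$ may be an infinite set of finite traces. -/

import Mathlib

/-! ### Traces, hyperproperties and (`k`-)safety -/

namespace Hyper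

/-- Infinite traces over the alphabet `α`, positions being counted from `0`. -/
abbrev Trace (α : Type) : Type := ℕ → α

/-- A hyperproperty over the alphabet `α`: a set of sets of infinite traces. -/
abbrev Hyperproperty (α : Type) : Type := Set (Set (Trace α))

/-- The finite trace `u` is a prefix of the infinite trace `t`. -/
def IsPrefixOf {α : Type} (u : List α) (t : Trace α) : Prop :=
  ∀ (i : ℕ) (h : i < u.length), u[i] = t i

/-- `U ≤ T` for a set `U` of finite traces and a set `T` of infinite traces: every element of `U`
is a prefix of some element of `T`. -/
def SetPrefix {α : Type} (U : Set (List α)) (T : Set (Trace α)) : Prop :=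
  ∀ u ∈ U, ∃ t ∈ T, IsPrefixOf u t

/-- The set `U` of finite traces is a bad prefix for `S`: no set of infinite traces extending `U`
belongs to `S`. -/
def IsBadPrefix {α : Type} (S : Hyperproperty α) (U : Set (List α)) : Prop :=
  ∀ T : Set (Trace α), SetPrefix U T → T ∉ S

/-- Safety hyperproperties: every violating set of traces has a finite bad prefix. -/
def IsSafety {α : Type} (S : Hyperproperty α) : Prop :=
  ∀ T : Set (Trace α), T ∉ S →
    ∃ U : Set (List α), U.Finite ∧ SetPrefix U T ∧ IsBadPrefix S U

/-- The variant of safety in which a bad prefix may be an infinite set of finite traces. -/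
def IsWeakSafety {α : Type} (S : Hyperproperty α) : Prop :=
  ∀ T : Set (Trace α), T ∉ S → ∃ U : Set (List α), SetPrefix U T ∧ IsBadPrefix S U

/-- `k`-safety hyperproperties: safety hyperproperties such that every violating set of traces has
a bad prefix with at most `k` elements. -/
def IsKSafety {α : Type} (k : ℕ) (S : Hyperproperty α) : Prop :=
  IsSafety S ∧ ∀ T : Set (Trace α), T ∉ S →
    ∃ U : Set (List α), U.encard ≤ k ∧ SetPrefix U T ∧ IsBadPrefix S U

/-! ### Syntax of HyperLTL -/

/-- Quantifier-free HyperLTL formulas. Atomic propositions and trace variables are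
natural numbers; `atom a x` is the proposition `a` indexed by the trace variable `x`. -/
inductive Body : Type
  | atom (a x : ℕ) : Body
  | neg (φ : Body) : Body
  | or (φ ψ : Body) : Body
  | next (φ : Body) : Body
  | untl (φ ψ : Body) : Body

/-- HyperLTL formulas: a prefix of trace quantifiers followed by a quantifier-free formula. -/
inductive HyperLTL : Type
  | body (φ : Body) : HyperLTL
  | all (x : ℕ) (ψ : HyperLTL) : HyperLTL
  | ex (x : ℕ) (ψ : HyperLTL) : HyperLTL

/-- The trace variables occurring in a quantifier-free formula. -/
def Body.vars : Body → Set ℕ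
  | .atom _ x => {x}
  | .neg φ => φ.vars
  | .or φ ψ => φ.vars ∪ ψ.vars
  | .next φ => φ.vars
  | .untl φ ψ => φ.vars ∪ ψ.vars

/-- The atomic propositions occurring in a quantifier-free formula. -/
def Body.props : Body → Set ℕ
  | .atom a _ => {a}
  | .neg φ => φ.props
  | .or φ ψ => φ.props ∪ ψ.props
  | .next φ => φ.props
  | .untl φ ψ => φ.props ∪ ψ.props

/-- The free trace variables of a formula. -/
def HyperLTL.freeVars : HyperLTL → Set ℕ
  | .body φ => φ.vars
  | .all x ψ => ψ.freeVars \ {x}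
  | .ex x ψ => ψ.freeVars \ {x}

/-- The atomic propositions occurring in a formula. -/
def HyperLTL.props : HyperLTL → Set ℕ
  | .body φ => φ.props
  | .all _ ψ => ψ.props
  | .ex _ ψ => ψ.props

/-- Closed formulas. -/
def HyperLTL.IsSentence (φ : HyperLTL) : Prop := φ.freeVars = ∅

/-! ### Semantics of HyperLTL -/

/-- The alphabet `2^AP` for a set `AP` of atomic propositions. -/
abbrev Letter (AP : Set ℕ) : Type := Set AP

/-- Trace assignments: partial functions from trace variables to traces. -/
abbrev Assignment (AP : Set ℕ) : Type := ℕ → Option (Trace (Letter AP))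

/-- The assignment `Π[i,∞]`, in which every assigned trace is replaced by its suffix from
position `i` on. -/
def Assignment.suffix {AP : Set ℕ} (P : Assignment AP) (i : ℕ) : Assignment AP :=
  fun x => (P x).map fun t n => t (n + i)

/-- Satisfaction of quantifier-free formulas. -/
def Body.Sat {AP : Set ℕ} : Body → Assignment AP → Prop
  | .atom a x, P => ∃ t, P x = some t ∧ ∃ h : a ∈ AP, (⟨a, h⟩ : AP) ∈ t 0
  | .neg φ, P => ¬ φ.Sat P
  | .or φ ψ, P => φ.Sat P ∨ ψ.Sat P
  | .next φ, P => φ.Sat (P.suffix 1)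
  | .untl φ ψ, P => ∃ i, ψ.Sat (P.suffix i) ∧ ∀ j < i, φ.Sat (P.suffix j)

/-- Satisfaction of formulas over a set `T` of traces. -/
def HyperLTL.Sat {AP : Set ℕ} (T : Set (Trace (Letter AP))) : HyperLTL → Assignment AP → Prop
  | .body φ, P => φ.Sat P
  | .all x ψ, P => ∀ t ∈ T, ψ.Sat T (Function.update P x (some t))
  | .ex x ψ, P => ∃ t ∈ T, ψ.Sat T (Function.update P x (some t))

/-- The hyperproperty over the alphabet `2^AP` expressed by a formula: the sets of traces that
satisfy it under the empty trace assignment. -/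
def HyperLTL.lang (AP : Set ℕ) (φ : HyperLTL) : Hyperproperty (Letter AP) :=
  {T | φ.Sat T (fun _ => none)}

/-! ### Gödel numbering of formulas, and decidability -/

/-- The code of a quantifier-free formula. -/
def Body.code : Body → ℕ
  | .atom a x => 5 * Nat.pair a x
  | .neg φ => 5 * φ.code + 1
  | .or φ ψ => 5 * Nat.pair φ.code ψ.code + 2
  | .next φ => 5 * φ.code + 3
  | .untl φ ψ => 5 * Nat.pair φ.code ψ.code + 4

/-- The quantifier-free formula with a given code. -/
def Body.ofCode (n : ℕ) : Body :=
  if h0 : n % 5 = 0 then .atom (n / 5).unpair.1 (n / 5).unpair.2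
  else if n % 5 = 1 then .neg (Body.ofCode (n / 5))
  else if n % 5 = 2 then .or (Body.ofCode (n / 5).unpair.1) (Body.ofCode (n / 5).unpair.2)
  else if n % 5 = 3 then .next (Body.ofCode (n / 5))
  else .untl (Body.ofCode (n / 5).unpair.1) (Body.ofCode (n / 5).unpair.2)
termination_by n
decreasing_by
  all_goals
    have h1 := Nat.unpair_left_le (n / 5)
    have h2 := Nat.unpair_right_le (n / 5)
    omega

theorem Body.ofCode_code (φ : Body) : Body.ofCode φ.code = φ := by
  induction φ with
  | atom a x =>
    rw [Body.code, Body.ofCode, dif_pos (by omega)]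
    simp
  | neg φ ih =>
    rw [Body.code, Body.ofCode, dif_neg (by omega), if_pos (by omega),
      show (5 * φ.code + 1) / 5 = φ.code by omega, ih]
  | or φ ψ ih1 ih2 =>
    rw [Body.code, Body.ofCode, dif_neg (by omega), if_neg (by omega), if_pos (by omega),
      show (5 * Nat.pair φ.code ψ.code + 2) / 5 = Nat.pair φ.code ψ.code by omega,
      Nat.unpair_pair, ih1, ih2]
  | next φ ih =>
    rw [Body.code, Body.ofCode, dif_neg (by omega), if_neg (by omega), if_neg (by omega),
      if_pos (by omega), show (5 * φ.code + 3) / 5 = φ.code by omega, ih]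
  | untl φ ψ ih1 ih2 =>
    rw [Body.code, Body.ofCode, dif_neg (by omega), if_neg (by omega), if_neg (by omega),
      if_neg (by omega),
      show (5 * Nat.pair φ.code ψ.code + 4) / 5 = Nat.pair φ.code ψ.code by omega,
      Nat.unpair_pair, ih1, ih2]

theorem Body.code_ofCode (n : ℕ) : (Body.ofCode n).code = n := by
  induction n using Nat.strong_induction_on with
  | _ n ih =>
    have h1 := Nat.unpair_left_le (n / 5)
    have h2 := Nat.unpair_right_le (n / 5)
    rw [Body.ofCode]
    split_ifs with h h' h' h'
    · rw [Body.code, Nat.pair_unpair]; omega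
    · rw [Body.code, ih _ (by omega)]; omega
    · rw [Body.code, ih _ (by omega), ih _ (by omega), Nat.pair_unpair]; omega
    · rw [Body.code, ih _ (by omega)]; omega
    · rw [Body.code, ih _ (by omega), ih _ (by omega), Nat.pair_unpair]; omega

/-- The code of a formula. -/
def HyperLTL.code : HyperLTL → ℕ
  | .body φ => 3 * φ.code
  | .all x ψ => 3 * Nat.pair x ψ.code + 1
  | .ex x ψ => 3 * Nat.pair x ψ.code + 2

/-- The formula with a given code. -/
def HyperLTL.ofCode (n : ℕ) : HyperLTL :=
  if h0 : n % 3 = 0 then .body (Body.ofCode (n / 3))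
  else if n % 3 = 1 then .all (n / 3).unpair.1 (HyperLTL.ofCode (n / 3).unpair.2)
  else .ex (n / 3).unpair.1 (HyperLTL.ofCode (n / 3).unpair.2)
termination_by n
decreasing_by
  all_goals
    have h2 := Nat.unpair_right_le (n / 3)
    omega

theorem HyperLTL.ofCode_code (φ : HyperLTL) : HyperLTL.ofCode φ.code = φ := by
  induction φ with
  | body φ =>
    rw [HyperLTL.code, HyperLTL.ofCode, dif_pos (by omega),
      show 3 * φ.code / 3 = φ.code by omega, Body.ofCode_code]
  | all x ψ ih =>
    rw [HyperLTL.code, HyperLTL.ofCode, dif_neg (by omega), if_pos (by omega),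
      show (3 * Nat.pair x ψ.code + 1) / 3 = Nat.pair x ψ.code by omega, Nat.unpair_pair, ih]
  | ex x ψ ih =>
    rw [HyperLTL.code, HyperLTL.ofCode, dif_neg (by omega), if_neg (by omega),
      show (3 * Nat.pair x ψ.code + 2) / 3 = Nat.pair x ψ.code by omega, Nat.unpair_pair, ih]

theorem HyperLTL.code_ofCode (n : ℕ) : (HyperLTL.ofCode n).code = n := by
  induction n using Nat.strong_induction_on with
  | _ n ih =>
    have h2 := Nat.unpair_right_le (n / 3)
    rw [HyperLTL.ofCode]
    split_ifs with h h'
    · rw [HyperLTL.code, Body.code_ofCode]; omega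
    · rw [HyperLTL.code, ih _ (by omega), Nat.pair_unpair]; omega
    · rw [HyperLTL.code, ih _ (by omega), Nat.pair_unpair]; omega

/-- Formulas are coded bijectively by natural numbers through `HyperLTL.code`; this is the coding
with respect to which Mathlib's `Computable` and `ComputablePred` are understood below. -/
instance : Denumerable HyperLTL :=
  Denumerable.mk' ⟨HyperLTL.code, HyperLTL.ofCode, HyperLTL.ofCode_code, HyperLTL.code_ofCode⟩

/-- A property of HyperLTL sentences is decidable if some computable predicate on formulas agrees
with it on all sentences (its values on formulas with free trace variables do not matter). -/
def DecidableOnSentences (p : HyperLTL → Prop) : Prop :=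
  ∃ q : HyperLTL → Prop, ComputablePred q ∧ ∀ φ : HyperLTL, φ.IsSentence → (q φ ↔ p φ)

end Hyper

namespace Hyper

/-! ### Derived connectives -/

/-! The halting problem reduces to all four questions at once. For a code `u` and an input `n`,
`haltFormula u n` is a closed sentence of shape ∃∀*∃*. If `u` halts on `n`, it is unsatisfiable, so
its language is empty and `k`-safe for every `k` (`isKSafety_empty`). If `u` diverges on `n`, it has
a model containing the blank trace, while the blank trace alone is not a model. Since even weak
safety forces closure under subsets (`not_isWeakSafety`), the weakest of the notions then fails.

The sentence expresses a Horn program over numbers. A trace codes a tagged triple: the tag is a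
proposition at position `0`, and each argument is the only position of one of three propositions, so
that equality and successor are definable (`Term.sat_toBody`). Variables and premises of clauses
become universally quantified traces (except for the constant zero), conclusions existentially
quantified ones. Hence every model represents all derivable facts (`exists_rep_of_derivable`).
Conversely, an interpretation closed under the clauses that contains the fact for zero and omits the
goal yields a model (`sat_modelTraces`); the blank trace is harmless there because it carries no
tag.

The program `codeProgram` evaluates a code: it is complete (`derivable_of_mem_eval`) and sound
(`codeProgram_sound`). -/

def Body.and (φ ψ : Body) : Body := .neg (.or (.neg φ) (.neg ψ))

def Body.imp (φ ψ : Body) : Body := .or (.neg φ) ψ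

def Body.iff (φ ψ : Body) : Body := (φ.imp ψ).and (ψ.imp φ)

/-- The tautology on the left of the until is made from `φ` itself, so no new trace variable enters.
-/
def Body.always (φ : Body) : Body := .neg (.untl (.or φ (.neg φ)) (.neg φ))

/-- The conjunction of a list of formulas; the empty conjunction mentions the variable `0`. -/
def Body.conj : List Body → Body
  | [] => .or (.atom 0 0) (.neg (.atom 0 0))
  | φ :: l => φ.and (Body.conj l)

section Semantics

variable {A : Set ℕ} (P : Assignment A)

@[simp] theorem Body.sat_neg (φ : Body) : (Body.neg φ).Sat P ↔ ¬ φ.Sat P := by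
  rw [Body.Sat]

@[simp] theorem Body.sat_or (φ ψ : Body) : (Body.or φ ψ).Sat P ↔ φ.Sat P ∨ ψ.Sat P := by
  rw [Body.Sat]

@[simp] theorem Body.sat_next (φ : Body) : (Body.next φ).Sat P ↔ φ.Sat (P.suffix 1) := by
  rw [Body.Sat]

@[simp] theorem Body.sat_and (φ ψ : Body) : (φ.and ψ).Sat P ↔ φ.Sat P ∧ ψ.Sat P := by
  simp only [Body.and, Body.sat_neg, Body.sat_or]; tauto

@[simp] theorem Body.sat_imp (φ ψ : Body) : (φ.imp ψ).Sat P ↔ (φ.Sat P → ψ.Sat P) := by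
  simp only [Body.imp, Body.sat_neg, Body.sat_or]; tauto

@[simp] theorem Body.sat_iff (φ ψ : Body) : (φ.iff ψ).Sat P ↔ (φ.Sat P ↔ ψ.Sat P) := by
  simp only [Body.iff, Body.sat_and, Body.sat_imp]; tauto

@[simp] theorem Body.sat_always (φ : Body) :
    φ.always.Sat P ↔ ∀ i, φ.Sat (P.suffix i) := by
  rw [Body.always, Body.sat_neg, Body.Sat]
  simp only [Body.sat_neg, Body.sat_or, em, implies_true, and_true, not_exists, not_not]

@[simp] theorem Body.sat_conj (l : List Body) : (Body.conj l).Sat P ↔ ∀ φ ∈ l, φ.Sat P := by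
  induction l with
  | nil => simp [Body.conj, em]
  | cons φ l ih => simp [Body.conj, ih]

/-- The proposition `a` belongs to the `i`-th letter of `t`. -/
def Holds (t : Trace (Letter A)) (i a : ℕ) : Prop := ∃ h : a ∈ A, (⟨a, h⟩ : A) ∈ t i

variable {P}

theorem Body.sat_atom {x : ℕ} {t : Trace (Letter A)} (h : P x = some t) (a : ℕ) :
    (Body.atom a x).Sat P ↔ Holds t 0 a := by
  simp [Body.Sat, h, Holds]

theorem Assignment.suffix_apply {x : ℕ} {t : Trace (Letter A)} (h : P x = some t) (i : ℕ) :
    P.suffix i x = some (fun n => t (n + i)) := by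
  simp [Assignment.suffix, h]

theorem Body.sat_atom_suffix {x : ℕ} {t : Trace (Letter A)} (h : P x = some t) (a i : ℕ) :
    (Body.atom a x).Sat (P.suffix i) ↔ Holds t i a := by
  rw [Body.sat_atom (Assignment.suffix_apply h i)]
  simp [Holds]

theorem Body.sat_iterate_next {x : ℕ} (a n : ℕ) : ∀ {P : Assignment A} {t : Trace (Letter A)},
    P x = some t → ((Body.next^[n] (Body.atom a x)).Sat P ↔ Holds t n a) := by
  induction n with
  | zero => intro P t h; exact Body.sat_atom h a
  | succ n ih =>
    intro P t h
    rw [Function.iterate_succ_apply', Body.sat_next, ih (Assignment.suffix_apply h 1)]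
    rfl

end Semantics

/-! ### Blocks of quantifiers -/

def HyperLTL.alls (l : List ℕ) (ψ : HyperLTL) : HyperLTL := l.foldr .all ψ

def HyperLTL.exs (l : List ℕ) (ψ : HyperLTL) : HyperLTL := l.foldr .ex ψ

section Blocks

variable {A : Set ℕ}

/-- The assignment that agrees with `f` on `l` and with `P` elsewhere. -/
def Assignment.override (P : Assignment A) (l : List ℕ) (f : ℕ → Trace (Letter A)) :
    Assignment A :=
  fun x => if x ∈ l then some (f x) else P x

theorem Assignment.override_cons (P : Assignment A) (x : ℕ) (l : List ℕ)
    (f : ℕ → Trace (Letter A)) :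
    P.override (x :: l) f = Assignment.override (Function.update P x (some (f x))) l f := by
  funext y
  by_cases hy : y = x
  · subst hy; simp [Assignment.override]
  · simp [Assignment.override, hy]

theorem HyperLTL.sat_alls {T : Set (Trace (Letter A))} (l : List ℕ) (ψ : HyperLTL) :
    ∀ {P : Assignment A}, (HyperLTL.alls l ψ).Sat T P →
      ∀ f : ℕ → Trace (Letter A), (∀ x, f x ∈ T) → ψ.Sat T (P.override l f) := by
  induction l with
  | nil => intro P h f _; exact h
  | cons x l ih =>
    intro P h f hf
    rw [Assignment.override_cons]
    exact ih (h (f x) (hf x)) f hf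

/-- One total choice function replaces the successive quantifiers. Totality needs a nonempty `T`;
without repetitions in `l`, changing the function at the head leaves the tail untouched. -/
theorem HyperLTL.sat_alls_of {T : Set (Trace (Letter A))} (hT : T.Nonempty) (l : List ℕ)
    (hl : l.Nodup) (ψ : HyperLTL) : ∀ {P : Assignment A},
      (∀ f : ℕ → Trace (Letter A), (∀ x, f x ∈ T) → ψ.Sat T (P.override l f)) →
        (HyperLTL.alls l ψ).Sat T P := by
  induction l with
  | nil => intro P h; exact h (fun _ => hT.some) fun _ => hT.some_mem
  | cons x l ih =>
    intro P h t ht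
    refine ih hl.of_cons fun f hf => ?_
    have := h (Function.update f x t) fun y => by
      by_cases hy : y = x
      · subst hy; simpa using ht
      · simpa [hy] using hf y
    rw [Assignment.override_cons, Function.update_self] at this
    convert this using 1
    funext y
    have hx : x ∉ l := (List.nodup_cons.1 hl).1
    by_cases hy : y = x
    · subst hy; simp [Assignment.override, hx]
    · simp [Assignment.override, hy]

theorem HyperLTL.sat_exs {T : Set (Trace (Letter A))} (hT : T.Nonempty) (l : List ℕ)
    (hl : l.Nodup) (ψ : HyperLTL) : ∀ {P : Assignment A}, (HyperLTL.exs l ψ).Sat T P →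
      ∃ f : ℕ → Trace (Letter A), (∀ x, f x ∈ T) ∧ ψ.Sat T (P.override l f) := by
  induction l with
  | nil => intro P h; exact ⟨fun _ => hT.some, fun _ => hT.some_mem, h⟩
  | cons x l ih =>
    rintro P ⟨t, ht, h⟩
    obtain ⟨f, hf, h⟩ := ih hl.of_cons h
    refine ⟨Function.update f x t, fun y => ?_, ?_⟩
    · by_cases hy : y = x
      · subst hy; simpa using ht
      · simpa [hy] using hf y
    rw [Assignment.override_cons, Function.update_self]
    convert h using 1
    funext y
    have hx : x ∉ l := (List.nodup_cons.1 hl).1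
    by_cases hy : y = x
    · subst hy; simp [Assignment.override, hx]
    · simp [Assignment.override, hy]

theorem HyperLTL.sat_exs_of {T : Set (Trace (Letter A))} (l : List ℕ) (ψ : HyperLTL) :
    ∀ {P : Assignment A} (f : ℕ → Trace (Letter A)), (∀ x, f x ∈ T) →
      ψ.Sat T (P.override l f) → (HyperLTL.exs l ψ).Sat T P := by
  induction l with
  | nil => intro P f _ h; exact h
  | cons x l ih =>
    intro P f hf h
    rw [Assignment.override_cons] at h
    exact ⟨f x, hf x, ih f hf h⟩

theorem HyperLTL.freeVars_alls (l : List ℕ) (ψ : HyperLTL) :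
    (HyperLTL.alls l ψ).freeVars = ψ.freeVars \ {x | x ∈ l} := by
  induction l with
  | nil => simp [HyperLTL.alls]
  | cons x l ih =>
    change (HyperLTL.alls l ψ).freeVars \ {x} = _
    rw [ih]; ext y; simp; tauto

theorem HyperLTL.freeVars_exs (l : List ℕ) (ψ : HyperLTL) :
    (HyperLTL.exs l ψ).freeVars = ψ.freeVars \ {x | x ∈ l} := by
  induction l with
  | nil => simp [HyperLTL.exs]
  | cons x l ih =>
    change (HyperLTL.exs l ψ).freeVars \ {x} = _
    rw [ih]; ext y; simp; tauto

end Blocks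

/-! ### Restriction of the set of atomic propositions -/

section Restriction

/-- The trace obtained by forgetting the propositions outside `A`. -/
def restrict (A : Set ℕ) (t : Trace (Letter Set.univ)) : Trace (Letter A) :=
  fun i => {a | (⟨a.1, trivial⟩ : (Set.univ : Set ℕ)) ∈ t i}

/-- Letters are consulted only at propositions of the formula, and forgetting the others commutes
with suffixes. This lets one model over all propositions serve every admissible alphabet. -/
theorem Body.sat_restrict {A : Set ℕ} (φ : Body) (hφ : φ.props ⊆ A) :
    ∀ P : Assignment Set.univ, φ.Sat (fun x => (P x).map (restrict A)) ↔ φ.Sat P := by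
  have hs : ∀ (P : Assignment Set.univ) (i : ℕ),
      Assignment.suffix (fun x => (P x).map (restrict A)) i =
        fun x => (P.suffix i x).map (restrict A) := by
    intro P i
    funext x
    simp only [Assignment.suffix, Option.map_map]
    rfl
  induction φ with
  | atom a x =>
    intro P
    have ha : a ∈ A := hφ rfl
    rcases hx : P x with _ | t <;> simp [Body.Sat, hx, ha, restrict]
  | neg φ ih => intro P; simp only [Body.sat_neg, ih hφ]
  | or φ ψ ih1 ih2 =>
    intro P
    simp only [Body.sat_or, ih1 (Set.union_subset_iff.1 hφ).1, ih2 (Set.union_subset_iff.1 hφ).2]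
  | next φ ih => intro P; simp only [Body.sat_next, hs, ih hφ]
  | untl φ ψ ih1 ih2 =>
    intro P
    simp only [Body.Sat, hs, ih1 (Set.union_subset_iff.1 hφ).1,
      ih2 (Set.union_subset_iff.1 hφ).2]

theorem HyperLTL.sat_restrict {A : Set ℕ} (T : Set (Trace (Letter Set.univ))) (φ : HyperLTL)
    (hφ : φ.props ⊆ A) : ∀ P : Assignment Set.univ,
      φ.Sat (restrict A '' T) (fun x => (P x).map (restrict A)) ↔ φ.Sat T P := by
  have hu : ∀ (P : Assignment Set.univ) (x : ℕ) (t : Trace (Letter Set.univ)),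
      Function.update (fun x => (P x).map (restrict A)) x (some (restrict A t)) =
        fun y => (Function.update P x (some t) y).map (restrict A) := by
    intro P x t
    funext y
    by_cases hy : y = x
    · subst hy; simp
    · simp [hy]
  induction φ with
  | body φ => exact fun P => Body.sat_restrict φ hφ P
  | all x ψ ih => intro P; simp only [HyperLTL.Sat, Set.forall_mem_image, hu, ih hφ]
  | ex x ψ ih => intro P; simp only [HyperLTL.Sat, Set.exists_mem_image, hu, ih hφ]

end Restriction

/-! ### Horn programs over tagged triples of natural numbers -/

/-- Terms of Horn clauses: variables and their successors. The variable `0` stands for zero. -/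
inductive Term : Type
  | var (i : ℕ) : Term
  | succ (i : ℕ) : Term

def Term.idx : Term → ℕ
  | .var i => i
  | .succ i => i

def Term.val (v : ℕ → ℕ) : Term → ℕ
  | .var i => v i
  | .succ i => v i + 1

/-- Atomic formulas of Horn clauses: a ternary predicate, named by its tag, applied to terms. -/
structure Atm : Type where
  tag : ℕ
  a : Term
  b : Term
  c : Term

structure Clause : Type where
  prems : List Atm
  concl : Atm

/-- The variables of the atomic formula are smaller than `V`. -/
def Atm.Bounded (V : ℕ) (p : Atm) : Prop := p.a.idx < V ∧ p.b.idx < V ∧ p.c.idx < V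

/-- The variables of the clause are smaller than `V`, and it has at most `M` premises. -/
def Clause.Bounded (V M : ℕ) (cl : Clause) : Prop :=
  (∀ p ∈ cl.prems, p.Bounded V) ∧ cl.concl.Bounded V ∧ cl.prems.length ≤ M

/-- Truth of an atomic formula under an interpretation of the tags. -/
def Atm.IsTrue (I : ℕ → ℕ → ℕ → ℕ → Prop) (v : ℕ → ℕ) (p : Atm) : Prop :=
  I p.tag (p.a.val v) (p.b.val v) (p.c.val v)

/-- The interpretation `I` satisfies all clauses of the program. -/
def ClosedUnder (Pr : List Clause) (I : ℕ → ℕ → ℕ → ℕ → Prop) : Prop :=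
  ∀ cl ∈ Pr, ∀ v : ℕ → ℕ, v 0 = 0 → (∀ p ∈ cl.prems, p.IsTrue I v) → cl.concl.IsTrue I v

/-- The least interpretation that satisfies a Horn program. -/
inductive Derivable (Pr : List Clause) : ℕ → ℕ → ℕ → ℕ → Prop
  | rule (cl : Clause) (hcl : cl ∈ Pr) (v : ℕ → ℕ) (hv : v 0 = 0)
      (h : ∀ p ∈ cl.prems, Derivable Pr p.tag (p.a.val v) (p.b.val v) (p.c.val v)) :
      Derivable Pr cl.concl.tag (cl.concl.a.val v) (cl.concl.b.val v) (cl.concl.c.val v)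

/-- The clause that generates the successor of a number; the tag `0` marks numbers. -/
def succClause : Clause := ⟨[], ⟨0, .succ 1, .var 0, .var 0⟩⟩

/-! ### Facts as traces -/

section Facts

variable {A : Set ℕ}

/-- The proposition `c` holds on `t` at position `v` and nowhere else. -/
def Codes (t : Trace (Letter A)) (c v : ℕ) : Prop := ∀ i, Holds t i c ↔ i = v

/-- The trace `t` represents the fact with the given tag and arguments. -/
def Rep (t : Trace (Letter A)) (τ x y z : ℕ) : Prop :=
  Holds t 0 (τ + 3) ∧ Codes t 0 x ∧ Codes t 1 y ∧ Codes t 2 z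

theorem Codes.unique {t : Trace (Letter A)} {c v w : ℕ} (h : Codes t c v) (h' : Codes t c w) :
    v = w :=
  (h' v).1 ((h v).2 rfl)

/-- The trace `x` codes at proposition `c` the value of the term. -/
def Term.toBody (c x : ℕ) : Term → Body
  | .var i => ((Body.atom c x).iff (.atom 0 i)).always
  | .succ i => (Body.neg (.atom c x)).and ((Body.next (.atom c x)).iff (.atom 0 i)).always

/-- The trace `x` represents the atomic formula. -/
def Atm.toBody (p : Atm) (x : ℕ) : Body :=
  (Body.atom (p.tag + 3) x).and ((p.a.toBody 0 x).and ((p.b.toBody 1 x).and (p.c.toBody 2 x)))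

variable {P : Assignment A} {h : ℕ → Trace (Letter A)} {N V : ℕ} {v : ℕ → ℕ}

/-- Each variable is read at proposition `0` of its trace. Equal values mean equal occurrences at
all positions; a successor means no occurrence at position `0` and agreement after a shift by one.
-/
theorem Term.sat_toBody (hP : ∀ x < N, P x = some (h x)) (hv : ∀ i < V, Codes (h i) 0 (v i))
    (hVN : V ≤ N) {t : Term} (ht : t.idx < V) (c : ℕ) {x : ℕ} (hx : x < N) :
    (t.toBody c x).Sat P ↔ Codes (h x) c (t.val v) := by
  cases t with
  | var i =>
    have hi : i < V := ht
    simp only [Term.toBody, Body.sat_always, Body.sat_iff, Body.sat_atom_suffix (hP x hx),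
      Body.sat_atom_suffix (hP i (hi.trans_le hVN)), hv i hi _, Term.val]
    rfl
  | succ i =>
    have hi : i < V := ht
    have hn : ∀ j, (Body.next (.atom c x)).Sat (P.suffix j) ↔ Holds (h x) (j + 1) c := fun j => by
      rw [Body.sat_next, Body.sat_atom_suffix (Assignment.suffix_apply (hP x hx) j), add_comm j]
      rfl
    simp only [Term.toBody, Body.sat_and, Body.sat_neg, Body.sat_always, Body.sat_iff, hn,
      Body.sat_atom (hP x hx), Body.sat_atom_suffix (hP i (hi.trans_le hVN)), hv i hi _, Term.val]
    constructor
    · rintro ⟨h0, h1⟩ (_ | j)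
      · simpa using h0
      · simpa using h1 j
    · intro hc
      exact ⟨by simp [hc 0], fun j => by simp [hc (j + 1)]⟩

theorem Atm.sat_toBody (hP : ∀ x < N, P x = some (h x)) (hv : ∀ i < V, Codes (h i) 0 (v i))
    (hVN : V ≤ N) {p : Atm} (hp : p.Bounded V) {x : ℕ} (hx : x < N) :
    (p.toBody x).Sat P ↔ p.IsTrue (fun τ a b c => Rep (h x) τ a b c) v := by
  simp only [Atm.toBody, Body.sat_and, Body.sat_atom (hP x hx),
    Term.sat_toBody hP hv hVN hp.1 _ hx, Term.sat_toBody hP hv hVN hp.2.1 _ hx,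
    Term.sat_toBody hP hv hVN hp.2.2 _ hx, Atm.IsTrue, Rep]

end Facts

/-! ### Horn programs as formulas -/

/-- If the premises of the clause are represented by the traces `V, V + 1, …`, then its conclusion
is represented by the trace `y`. -/
def Clause.toBody (V y : ℕ) (cl : Clause) : Body :=
  (Body.conj (cl.prems.zipIdx.map fun p => p.1.toBody (V + p.2))).imp (cl.concl.toBody y)

/-- The trace `0` is tagged as a number and codes zero. -/
def zeroBody : Body :=
  (Body.atom 3 0).and ((Body.atom 0 0).and (Body.next (Body.neg (.atom 0 0)).always))

/-- Traces below `V` hold the variables of the clauses, the next `M` hold premises, and trace `V + M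
+ r` answers for clause `r`. The clauses are guarded by the demand that all variable traces be
tagged as numbers. -/
def progBody (Pr : List Clause) (V M : ℕ) : Body :=
  zeroBody.and
    ((Body.conj ((List.range V).map fun i => Body.atom 3 i)).imp
      (Body.conj (Pr.zipIdx.map fun cl => cl.1.toBody V (V + M + cl.2))))

/-- The trace `x` represents a fact with tag `g` and first argument `n`. -/
def goalBody (x g n : ℕ) : Body := (Body.atom (g + 3) x).and (Body.next^[n] (Body.atom 0 x))

def quantified (Pr : List Clause) (V M : ℕ) (φ : Body) : HyperLTL :=
  .ex 0 (.alls (List.range' 1 (V + M - 1)) (.exs (List.range' (V + M) Pr.length) (.body φ)))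

/-- The sentence stating that the set of traces contains the numbers, is closed under the program,
and does not contain a fact with tag `g` and first argument `n`. -/
def hornFormula (Pr : List Clause) (V M g n : ℕ) : HyperLTL :=
  quantified Pr V M ((progBody Pr V M).and (goalBody V g n).neg)

section Semantics

variable {A : Set ℕ} {P : Assignment A} {h : ℕ → Trace (Letter A)} {V M : ℕ} {v : ℕ → ℕ}
  {Pr : List Clause}

theorem sat_zeroBody (h0 : P 0 = some (h 0)) :
    zeroBody.Sat P ↔ Holds (h 0) 0 3 ∧ Codes (h 0) 0 0 := by
  have hn : ∀ j, (Body.atom 0 0).Sat ((P.suffix 1).suffix j) ↔ Holds (h 0) (j + 1) 0 := fun j => by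
    rw [Body.sat_atom_suffix (Assignment.suffix_apply h0 1)]
    rfl
  simp only [zeroBody, Body.sat_and, Body.sat_atom h0, Body.sat_next, Body.sat_always,
    Body.sat_neg, hn]
  refine and_congr_right fun _ => ⟨?_, fun hc => ⟨(hc 0).2 rfl, fun j => by simp [hc (j + 1)]⟩⟩
  rintro ⟨h1, h2⟩ (_ | j)
  · simpa using h1
  · simpa using h2 j

theorem Clause.sat_toBody (hP : ∀ x < V + M + Pr.length, P x = some (h x))
    (hv : ∀ i < V, Codes (h i) 0 (v i)) {cl : Clause} (hcl : cl.Bounded V M) {y : ℕ}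
    (hy : y < V + M + Pr.length) :
    (cl.toBody V y).Sat P ↔
      ((∀ (p : Atm) (j : ℕ), cl.prems[j]? = some p →
          p.IsTrue (fun τ a b c => Rep (h (V + j)) τ a b c) v) →
        cl.concl.IsTrue (fun τ a b c => Rep (h y) τ a b c) v) := by
  have hVN : V ≤ V + M + Pr.length := by omega
  rw [Clause.toBody, Body.sat_imp, Atm.sat_toBody hP hv hVN hcl.2.1 hy]
  refine imp_congr_left ?_
  simp only [Body.sat_conj, List.forall_mem_map, Prod.forall, List.mem_zipIdx_iff_getElem?]
  refine forall_congr' fun p => forall_congr' fun j => imp_congr_right fun hj => ?_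
  have hjl : j < cl.prems.length := (List.getElem?_eq_some_iff.1 hj).1
  have := hcl.2.2
  exact Atm.sat_toBody hP hv hVN (hcl.1 p (List.mem_of_getElem? hj)) (by omega)

theorem sat_goalBody {x : ℕ} (hx : P x = some (h x)) (g n : ℕ) :
    (goalBody x g n).Sat P ↔ Holds (h x) 0 (g + 3) ∧ Holds (h x) n 0 := by
  rw [goalBody, Body.sat_and, Body.sat_atom hx, Body.sat_iterate_next _ _ hx]

/-- The assignment built by the quantifiers of `quantified`. -/
theorem quantified_assignment (hV : 0 < V) (z : Trace (Letter A)) (f e : ℕ → Trace (Letter A))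
    {x : ℕ} (hx : x < V + M + Pr.length) :
    Assignment.override (Assignment.override (Function.update (fun _ => none) 0 (some z))
      (List.range' 1 (V + M - 1)) f) (List.range' (V + M) Pr.length) e x =
      some (if x = 0 then z else if x < V + M then f x else e x) := by
  simp only [Assignment.override, List.mem_range'_1]
  by_cases h0 : x = 0
  · subst h0
    simp; omega
  · by_cases h1 : x < V + M
    · rw [if_neg (by omega), if_pos (by omega), if_neg h0, if_pos h1]
    · rw [if_pos (by omega), if_neg h0, if_neg h1]

/-- The zero trace `z` is chosen first, so it is the same for all later choices `f`; this allows
facts to be derived one after another. -/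
theorem sat_quantified {T : Set (Trace (Letter A))} (hV : 0 < V) {φ : Body}
    (hs : (quantified Pr V M φ).Sat T (fun _ => none)) :
    ∃ z ∈ T, ∀ f : ℕ → Trace (Letter A), (∀ x, f x ∈ T) → f 0 = z →
      ∃ (h : ℕ → Trace (Letter A)) (P : Assignment A), (∀ x, h x ∈ T) ∧
        (∀ x < V + M, h x = f x) ∧ (∀ x < V + M + Pr.length, P x = some (h x)) ∧ φ.Sat P := by
  obtain ⟨z, hz, hs⟩ := hs
  refine ⟨z, hz, fun f hf h0 => ?_⟩
  obtain ⟨e, he, hs⟩ := HyperLTL.sat_exs ⟨z, hz⟩ _ List.nodup_range' _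
    (HyperLTL.sat_alls _ _ hs f hf)
  refine ⟨_, _, ?_, ?_, fun x hx => quantified_assignment hV z f e hx, hs⟩
  · intro x
    split_ifs
    exacts [hz, hf x, he x]
  · intro x hx
    by_cases hx0 : x = 0
    · simp [hx0, h0]
    · simp [hx0, hx]

theorem sat_quantified_of {T : Set (Trace (Letter A))} (hV : 0 < V) {φ : Body}
    {z : Trace (Letter A)} (hz : z ∈ T)
    (hs : ∀ f : ℕ → Trace (Letter A), (∀ x, f x ∈ T) → f 0 = z →
      ∃ e : ℕ → Trace (Letter A), (∀ r, e r ∈ T) ∧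
        ∀ (h : ℕ → Trace (Letter A)) (P : Assignment A), (∀ x < V + M, h x = f x) →
          (∀ r < Pr.length, h (V + M + r) = e r) →
          (∀ x < V + M + Pr.length, P x = some (h x)) → φ.Sat P) :
    (quantified Pr V M φ).Sat T (fun _ => none) := by
  refine ⟨z, hz, HyperLTL.sat_alls_of ⟨z, hz⟩ _ List.nodup_range' _ fun f hf => ?_⟩
  -- Variable `0` lies outside the universal block, so the value of `f` there can be reset to `z`.
  obtain ⟨e, he, hs⟩ := hs (Function.update f 0 z) (fun x => by
    by_cases hx : x = 0
    · subst hx; simpa using hz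
    · simpa [hx] using hf x) (by simp)
  refine HyperLTL.sat_exs_of _ _ (fun x => e (x - (V + M))) (fun x => he _) ?_
  refine hs _ _ ?_ ?_ fun x hx => quantified_assignment hV z f _ hx
  · intro x hx
    by_cases hx0 : x = 0
    · simp [hx0]
    · simp [hx0, hx]
  · intro r _
    rw [if_neg (by omega), if_neg (by omega), Nat.add_sub_cancel_left]

/-- In a model of the formula every derivable fact is represented by a trace. -/
theorem exists_rep_of_derivable {T : Set (Trace (Letter A))} (hV : 1 < V) (hM : 0 < M)
    (hB : ∀ cl ∈ Pr, cl.Bounded V M) (hsucc : succClause ∈ Pr) {g n : ℕ}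
    (hs : (hornFormula Pr V M g n).Sat T (fun _ => none)) {τ a b c : ℕ}
    (hd : Derivable Pr τ a b c) : ∃ t ∈ T, Rep t τ a b c := by
  obtain ⟨z, hzT, hs⟩ := sat_quantified (by omega) hs
  -- One application of a clause: traces for the variables and premises produce a trace for the
  -- conclusion.
  have key : ∀ f : ℕ → Trace (Letter A), (∀ x, f x ∈ T) → f 0 = z →
      (Holds z 0 3 ∧ Codes z 0 0) ∧ ∀ v : ℕ → ℕ,
        (∀ i < V, Holds (f i) 0 3 ∧ Codes (f i) 0 (v i)) → ∀ cl ∈ Pr,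
        (∀ (p : Atm) (j : ℕ), cl.prems[j]? = some p →
          p.IsTrue (fun τ a b c => Rep (f (V + j)) τ a b c) v) →
          ∃ t ∈ T, cl.concl.IsTrue (fun τ a b c => Rep t τ a b c) v := by
    intro f hf h0
    obtain ⟨h, P, hT, hhf, hP, hs⟩ := hs f hf h0
    have hz : h 0 = z := by rw [hhf 0 (by omega), h0]
    simp only [progBody, Body.sat_and, sat_zeroBody (hP 0 (by omega)), Body.sat_imp,
      Body.sat_conj, List.forall_mem_map, List.mem_range, hz] at hs
    refine ⟨hs.1.1, fun v hv cl hcl hp => ?_⟩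
    obtain ⟨r, hr⟩ := List.mem_iff_getElem?.1 hcl
    have hrl : r < Pr.length := (List.getElem?_eq_some_iff.1 hr).1
    have hcl' := hs.1.2 (fun i hi => by
      rw [Body.sat_atom (hP i (by omega)), hhf i (by omega)]; exact (hv i hi).1) (cl, r)
      (List.mem_zipIdx_iff_getElem?.2 hr)
    rw [Clause.sat_toBody (v := v) hP (fun i hi => by rw [hhf i (by omega)]; exact (hv i hi).2)
      (hB cl hcl) (by omega)] at hcl'
    refine ⟨_, hT _, hcl' fun p j hj => ?_⟩
    have hjl : j < cl.prems.length := (List.getElem?_eq_some_iff.1 hj).1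
    have := (hB cl hcl).2.2
    rw [hhf (V + j) (by omega)]
    exact hp p j hj
  have hz := (key (fun _ => z) (fun _ => hzT) rfl).1
  -- The guard asks for a number trace for each variable, even one absent from the premises, so all
  -- numbers are first generated from zero by `succClause`.
  have hnum : ∀ k, ∃ t ∈ T, Holds t 0 3 ∧ Codes t 0 k := by
    intro k
    induction k with
    | zero => exact ⟨z, hzT, hz⟩
    | succ k ih =>
      obtain ⟨s, hsT, hs⟩ := ih
      obtain ⟨t, ht, h⟩ := (key (fun x => if x = 1 then s else z)
        (fun x => by split_ifs <;> assumption) (by simp)).2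
        (fun i => if i = 1 then k else 0) (fun i _ => by split_ifs <;> assumption)
        succClause hsucc (by simp [succClause])
      exact ⟨t, ht, h.1, h.2.1⟩
  choose num hnumT hnum using hnum
  induction hd with
  | rule cl hcl v hv _ ih =>
    choose! w hwT hw using ih
    have hj : ∀ {x : ℕ} {p : Atm}, cl.prems[x - V]? = some p → p ∈ cl.prems :=
      fun h => List.mem_of_getElem? h
    obtain ⟨t, ht, h⟩ := (key
      -- Variables receive number traces and premises the traces from the induction hypothesis;
      -- unused premise slots default to `z`.
      (fun x => if x = 0 then z else if x < V then num (v x) else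
        (cl.prems[x - V]?.elim z fun p => w p))
      (fun x => by
        split_ifs with h0 h1
        · exact hzT
        · exact hnumT _
        · rcases hx : cl.prems[x - V]? with _ | p
          · exact hzT
          · exact hwT p (hj hx)) (by simp)).2 v
      (fun i hi => by
        split_ifs with h0
        · rw [h0, hv]; exact hz
        · exact hnum _) cl hcl (by
        intro p j hp
        have h0 : V + j ≠ 0 := by omega
        have h1 : ¬ V + j < V := by omega
        simp only [h0, h1, if_false, Nat.add_sub_cancel_left, hp, Option.elim]
        exact hw p (List.mem_of_getElem? hp))
    exact ⟨t, ht, h⟩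

/-- The goal is tested on trace `V`, a premise slot and hence universally quantified as `M` is
positive; a trace representing the goal can be put there. -/
theorem not_derivable_of_sat {T : Set (Trace (Letter A))} (hV : 1 < V) (hM : 0 < M)
    (hB : ∀ cl ∈ Pr, cl.Bounded V M) (hsucc : succClause ∈ Pr) {g n : ℕ}
    (hs : (hornFormula Pr V M g n).Sat T (fun _ => none)) (b c : ℕ) :
    ¬ Derivable Pr g n b c := by
  intro hd
  obtain ⟨t, ht, hr⟩ := exists_rep_of_derivable hV hM hB hsucc hs hd
  obtain ⟨z, hzT, hs⟩ := sat_quantified (by omega) hs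
  obtain ⟨h, P, -, hhf, hP, hs⟩ := hs (fun x => if x = 0 then z else t)
    (fun x => by split_ifs <;> assumption) (by simp)
  rw [Body.sat_and, Body.sat_neg, sat_goalBody (hP V (by omega)), hhf V (by omega),
    if_neg (by omega)] at hs
  exact hs.2 ⟨hr.1, (hr.2.1 n).2 rfl⟩

/-! ### Models of Horn programs as sets of traces -/

/-- The canonical trace that represents a fact. -/
def factTrace (τ x y z : ℕ) : Trace (Letter Set.univ) := fun i =>
  {p | p.1 = τ + 3 ∧ i = 0 ∨ p.1 = 0 ∧ i = x ∨ p.1 = 1 ∧ i = y ∨ p.1 = 2 ∧ i = z}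

/-- The trace on which no proposition ever holds. -/
def blankTrace (A : Set ℕ) : Trace (Letter A) := fun _ => ∅

theorem not_holds_blankTrace (i a : ℕ) : ¬ Holds (blankTrace A) i a := by
  rintro ⟨h, h'⟩; exact h'

theorem holds_factTrace {τ x y z i p : ℕ} : Holds (factTrace τ x y z) i p ↔
    p = τ + 3 ∧ i = 0 ∨ p = 0 ∧ i = x ∨ p = 1 ∧ i = y ∨ p = 2 ∧ i = z := by
  simp [Holds, factTrace]

theorem rep_factTrace (τ x y z : ℕ) : Rep (factTrace τ x y z) τ x y z := by
  refine ⟨?_, fun i => ?_, fun i => ?_, fun i => ?_⟩ <;> rw [holds_factTrace] <;> omega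

/-- The representations of the facts of the interpretation `I`, together with the blank trace. -/
def modelTraces (I : ℕ → ℕ → ℕ → ℕ → Prop) : Set (Trace (Letter Set.univ)) :=
  insert (blankTrace _) {t | ∃ τ x y z, I τ x y z ∧ t = factTrace τ x y z}

/-- A tag at position `0` excludes the blank trace, and propositions from `3` on occur only as tags,
so the tag is that of the fact. -/
theorem exists_of_mem_modelTraces {I : ℕ → ℕ → ℕ → ℕ → Prop} {t : Trace (Letter Set.univ)}
    (ht : t ∈ modelTraces I) {τ : ℕ} (hτ : Holds t 0 (τ + 3)) :
    ∃ x y z, I τ x y z ∧ t = factTrace τ x y z := by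
  rcases ht with rfl | ⟨σ, x, y, z, hI, rfl⟩
  · exact absurd hτ (not_holds_blankTrace _ _)
  · obtain rfl : τ = σ := by rw [holds_factTrace] at hτ; omega
    exact ⟨x, y, z, hI, rfl⟩

theorem of_mem_modelTraces_of_rep {I : ℕ → ℕ → ℕ → ℕ → Prop} {t : Trace (Letter Set.univ)}
    (ht : t ∈ modelTraces I) {τ x y z : ℕ} (hr : Rep t τ x y z) : I τ x y z := by
  obtain ⟨x', y', z', hI, rfl⟩ := exists_of_mem_modelTraces ht hr.1
  have hr' := rep_factTrace τ x' y' z'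
  rwa [hr.2.1.unique hr'.2.1, hr.2.2.1.unique hr'.2.2.1, hr.2.2.2.unique hr'.2.2.2]

/-- If the variable traces are all numbers, they determine a valuation, and closure of `I` supplies
the conclusion of each clause whose premises are represented. Otherwise the guard fails and any
witness does. -/
theorem sat_modelTraces {I : ℕ → ℕ → ℕ → ℕ → Prop} (hV : 0 < V) (hM : 0 < M)
    (hB : ∀ cl ∈ Pr, cl.Bounded V M) (hI : ClosedUnder Pr I) (h0 : I 0 0 0 0) {g n : ℕ}
    (hg : ∀ y z, ¬ I g n y z) :
    (hornFormula Pr V M g n).Sat (modelTraces I) (fun _ => none) := by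
  have hzT : factTrace 0 0 0 0 ∈ modelTraces I := Or.inr ⟨0, 0, 0, 0, h0, rfl⟩
  refine sat_quantified_of hV hzT fun f hf hf0 => ?_
  have hgoal : ¬ (Holds (f V) 0 (g + 3) ∧ Holds (f V) n 0) := by
    rintro ⟨h1, h2⟩
    obtain ⟨x, y, z, hI', ht⟩ := exists_of_mem_modelTraces (hf V) h1
    rw [ht, (rep_factTrace g x y z).2.1] at h2
    exact hg y z (h2 ▸ hI')
  have hzero : Holds (f 0) 0 3 ∧ Codes (f 0) 0 0 := by
    rw [hf0]; exact ⟨(rep_factTrace 0 0 0 0).1, (rep_factTrace 0 0 0 0).2.1⟩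
  by_cases hnum : ∀ i < V, Holds (f i) 0 3
  · have hv : ∀ i, ∃ k, i < V → Codes (f i) 0 k := fun i => by
      by_cases hi : i < V
      · obtain ⟨x, y, z, -, ht⟩ := exists_of_mem_modelTraces (τ := 0) (hf i) (hnum i hi)
        exact ⟨x, fun _ => ht ▸ (rep_factTrace 0 x y z).2.1⟩
      · exact ⟨0, fun h => absurd h hi⟩
    choose v hv using hv
    have hv0 : v 0 = 0 := (hv 0 hV).unique hzero.2
    have he : ∀ r : ℕ, ∃ t ∈ modelTraces I, ∀ cl : Clause, Pr[r]? = some cl →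
        (∀ (p : Atm) (j : ℕ), cl.prems[j]? = some p →
          p.IsTrue (fun τ a b c => Rep (f (V + j)) τ a b c) v) →
          cl.concl.IsTrue (fun τ a b c => Rep t τ a b c) v := by
      intro r
      by_cases hr : ∃ cl, Pr[r]? = some cl ∧ ∀ (p : Atm) (j : ℕ), cl.prems[j]? = some p →
          p.IsTrue (fun τ a b c => Rep (f (V + j)) τ a b c) v
      · obtain ⟨cl, hcl, hp⟩ := hr
        refine ⟨_, Or.inr ⟨_, _, _, _, hI cl (List.mem_of_getElem? hcl) v hv0 fun p hpm => ?_, rfl⟩,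
          fun cl' hcl' _ => ?_⟩
        · obtain ⟨j, hj⟩ := List.mem_iff_getElem?.1 hpm
          exact of_mem_modelTraces_of_rep (hf _) (hp p j hj)
        · obtain rfl : cl = cl' := by rw [hcl] at hcl'; exact Option.some.inj hcl'
          exact rep_factTrace _ _ _ _
      -- With a premise unrepresented, or no clause of this index, the trace of zero is an arbitrary
      -- witness.
      · exact ⟨_, hzT, fun cl hcl hp => absurd ⟨cl, hcl, hp⟩ hr⟩
    choose e heT he using he
    refine ⟨e, heT, fun h P hhf hhe hP => ?_⟩
    simp only [progBody, Body.sat_and, Body.sat_neg, sat_goalBody (hP V (by omega)),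
      sat_zeroBody (hP 0 (by omega)), hhf V (by omega), hhf 0 (by omega), Body.sat_imp]
    refine ⟨⟨hzero, fun _ => ?_⟩, hgoal⟩
    simp only [Body.sat_conj, List.forall_mem_map, Prod.forall, List.mem_zipIdx_iff_getElem?]
    intro cl r hr
    have hrl : r < Pr.length := (List.getElem?_eq_some_iff.1 hr).1
    have hcB := hB cl (List.mem_of_getElem? hr)
    rw [Clause.sat_toBody (v := v) hP (fun i hi => by rw [hhf i (by omega)]; exact hv i hi) hcB
      (by omega), hhe r hrl]
    refine fun hp => he r cl hr fun p j hj => ?_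
    have hjl : j < cl.prems.length := (List.getElem?_eq_some_iff.1 hj).1
    have := hcB.2.2
    rw [← hhf (V + j) (by omega)]
    exact hp p j hj
  · push Not at hnum
    obtain ⟨i, hi, hni⟩ := hnum
    refine ⟨fun _ => _, fun _ => hzT, fun h P hhf _ hP => ?_⟩
    simp only [progBody, Body.sat_and, Body.sat_neg, sat_goalBody (hP V (by omega)),
      sat_zeroBody (hP 0 (by omega)), hhf V (by omega), hhf 0 (by omega), Body.sat_imp]
    refine ⟨⟨hzero, fun hc => absurd ?_ hni⟩, hgoal⟩
    rw [Body.sat_conj, List.forall_mem_map] at hc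
    have := hc i (List.mem_range.2 hi)
    rwa [Body.sat_atom (hP i (by omega)), hhf i (by omega)] at this

/-- The blank trace satisfies no instance of the formula. -/
theorem not_sat_singleton_blank (hV : 0 < V) (g n : ℕ) :
    ¬ (hornFormula Pr V M g n).Sat {blankTrace A} (fun _ => none) := by
  intro hs
  obtain ⟨z, hz, hs⟩ := sat_quantified hV hs
  obtain ⟨h, P, hT, -, hP, hs⟩ := hs (fun _ => z) (fun _ => hz) rfl
  rw [Body.sat_and, progBody, Body.sat_and, sat_zeroBody (hP 0 (by omega)), hT 0] at hs
  exact not_holds_blankTrace _ _ hs.1.1.1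

end Semantics

/-! ### The formula is closed -/

theorem Body.vars_conj (l : List Body) (N : ℕ) (hN : 0 < N) (h : ∀ φ ∈ l, φ.vars ⊆ Set.Iio N) :
    (Body.conj l).vars ⊆ Set.Iio N := by
  induction l with
  | nil => simpa [Body.conj, Body.vars] using hN
  | cons φ l ih =>
    simp only [List.forall_mem_cons] at h
    exact Set.union_subset h.1 (ih h.2)

theorem Term.vars_toBody {t : Term} {c x N : ℕ} (ht : t.idx < N) (hx : x < N) :
    (t.toBody c x).vars ⊆ Set.Iio N := by
  cases t <;> simp_all [Term.toBody, Term.idx, Body.always, Body.iff, Body.imp, Body.and, Body.vars,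
    Set.insert_subset_iff]

theorem Atm.vars_toBody {p : Atm} {x N : ℕ} (hp : p.Bounded N) (hx : x < N) :
    (p.toBody x).vars ⊆ Set.Iio N :=
  Set.union_subset (by simpa [Body.vars] using hx) (Set.union_subset (Term.vars_toBody hp.1 hx)
    (Set.union_subset (Term.vars_toBody hp.2.1 hx) (Term.vars_toBody hp.2.2 hx)))

theorem Atm.Bounded.mono {p : Atm} {V N : ℕ} (hp : p.Bounded V) (h : V ≤ N) : p.Bounded N :=
  ⟨hp.1.trans_le h, hp.2.1.trans_le h, hp.2.2.trans_le h⟩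

theorem Body.vars_iterate_next (n : ℕ) (φ : Body) : (Body.next^[n] φ).vars = φ.vars := by
  induction n with
  | zero => rfl
  | succ n ih => rw [Function.iterate_succ_apply']; exact ih

theorem vars_progBody {Pr : List Clause} {V M : ℕ} (hV : 0 < V)
    (hB : ∀ cl ∈ Pr, cl.Bounded V M) :
    (progBody Pr V M).vars ⊆ Set.Iio (V + M + Pr.length) := by
  have hN : 0 < V + M + Pr.length := by omega
  refine Set.union_subset ?_ (Set.union_subset ?_ ?_)
  · simp [zeroBody, Body.always, Body.and, Body.vars, hN]
  · refine Body.vars_conj _ _ hN (List.forall_mem_map.2 fun i hi => ?_)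
    have := List.mem_range.1 hi
    simp only [Body.vars, Set.singleton_subset_iff, Set.mem_Iio]
    omega
  · refine Body.vars_conj _ _ hN (List.forall_mem_map.2 fun ⟨cl, r⟩ hr => ?_)
    rw [List.mem_zipIdx_iff_getElem?] at hr
    have hrl : r < Pr.length := (List.getElem?_eq_some_iff.1 hr).1
    have hcB := hB cl (List.mem_of_getElem? hr)
    refine Set.union_subset ?_ (Atm.vars_toBody (hcB.2.1.mono (by omega)) (by dsimp only; omega))
    refine Body.vars_conj _ _ hN (List.forall_mem_map.2 fun ⟨p, j⟩ hj => ?_)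
    rw [List.mem_zipIdx_iff_getElem?] at hj
    have hjl : j < cl.prems.length := (List.getElem?_eq_some_iff.1 hj).1
    have := hcB.2.2
    exact Atm.vars_toBody ((hcB.1 p (List.mem_of_getElem? hj)).mono (by omega))
      (by dsimp only; omega)

theorem hornFormula_isSentence {Pr : List Clause} {V M : ℕ} (hV : 0 < V) (hM : 0 < M)
    (hB : ∀ cl ∈ Pr, cl.Bounded V M) (g n : ℕ) : (hornFormula Pr V M g n).IsSentence := by
  have hv : ((progBody Pr V M).and (goalBody V g n).neg).vars ⊆ Set.Iio (V + M + Pr.length) := by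
    refine Set.union_subset (vars_progBody hV hB) (Set.union_subset ?_ ?_)
    · simp only [Body.vars, Set.singleton_subset_iff, Set.mem_Iio]; omega
    · simp only [Body.vars, Body.vars_iterate_next, Set.singleton_subset_iff, Set.mem_Iio]; omega
  simp only [HyperLTL.IsSentence, hornFormula, quantified, HyperLTL.freeVars,
    HyperLTL.freeVars_alls, HyperLTL.freeVars_exs, List.mem_range'_1]
  refine Set.eq_empty_of_forall_notMem fun x hx => ?_
  have := hv hx.1.1.1
  simp only [Set.mem_sdiff, Set.mem_ofPred_eq, Set.mem_singleton_iff, Set.mem_Iio] at hx this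
  omega

open Nat.Partrec (Code)

/-! ### A Horn program for the evaluation of codes of partial recursive functions -/

/-- The tag of the graph of `Code.eval c`. -/
def fnTag (c : Code) : ℕ := 2 * Encodable.encode c + 3

/-- The tag of the graph of `Code.eval c`, the argument being given as a pair. -/
def pairFnTag (c : Code) : ℕ := 2 * Encodable.encode c + 4

/-- The intended meaning of the tags: `0` marks numbers, `1` is the graph of `Nat.pair`, `2` is the
strict order, and the others are the graphs of the functions computed by codes. -/
def codeInterp : ℕ → ℕ → ℕ → ℕ → Prop
  | 0, _, _, _ => True
  | 1, x, y, z => Nat.pair x y = z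
  | 2, x, y, _ => x < y
  | n + 3, x, y, z =>
    if n % 2 = 0 then y ∈ (Denumerable.ofNat Code (n / 2)).eval x
    else z ∈ (Denumerable.ofNat Code (n / 2)).eval (Nat.pair x y)

theorem codeInterp_one (x y z : ℕ) : codeInterp 1 x y z ↔ Nat.pair x y = z := Iff.rfl

@[simp] theorem codeInterp_fnTag (c : Code) (x y z : ℕ) :
    codeInterp (fnTag c) x y z ↔ y ∈ c.eval x := by
  simp [fnTag, codeInterp]

@[simp] theorem codeInterp_pairFnTag (c : Code) (x y z : ℕ) :
    codeInterp (pairFnTag c) x y z ↔ z ∈ c.eval (Nat.pair x y) := by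
  have h1 : (2 * Encodable.encode c + 1) % 2 = 1 := by omega
  have h2 : (2 * Encodable.encode c + 1) / 2 = Encodable.encode c := by omega
  simp [pairFnTag, codeInterp, h1, h2]

section Clauses

open Term (var)

/-- Clauses for the strict order and for the graph of `Nat.pair`, enumerated along its values. -/
def arithClauses : List Clause :=
  [⟨[], ⟨2, var 0, .succ 1, var 0⟩⟩,
   ⟨[⟨2, var 1, var 2, var 0⟩], ⟨2, .succ 1, .succ 2, var 0⟩⟩,
   ⟨[], ⟨1, var 0, var 0, var 0⟩⟩,
   ⟨[⟨1, var 1, var 2, var 3⟩, ⟨2, .succ 1, var 2, var 0⟩], ⟨1, .succ 1, var 2, .succ 3⟩⟩,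
   ⟨[⟨1, var 1, .succ 1, var 3⟩], ⟨1, .succ 1, var 0, .succ 3⟩⟩,
   ⟨[⟨1, var 1, var 2, var 3⟩, ⟨2, var 2, var 1, var 0⟩], ⟨1, var 1, .succ 2, .succ 3⟩⟩,
   ⟨[⟨1, var 1, var 1, var 3⟩], ⟨1, var 0, .succ 1, .succ 3⟩⟩]

/-- The clause that passes from a pair of arguments to a single argument. -/
def unpairClause (c : Code) : Clause :=
  ⟨[⟨pairFnTag c, var 1, var 2, var 3⟩, ⟨1, var 1, var 2, var 4⟩], ⟨fnTag c, var 4, var 3, var 0⟩⟩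

/-- Clauses for the graph of the function computed by a code. -/
def codeClauses : Code → List Clause
  | .zero => [⟨[], ⟨fnTag .zero, var 1, var 0, var 0⟩⟩]
  | .succ => [⟨[], ⟨fnTag .succ, var 1, .succ 1, var 0⟩⟩]
  | .left => [⟨[⟨1, var 1, var 2, var 3⟩], ⟨fnTag .left, var 3, var 1, var 0⟩⟩]
  | .right => [⟨[⟨1, var 1, var 2, var 3⟩], ⟨fnTag .right, var 3, var 2, var 0⟩⟩]
  | .pair f g =>
    ⟨[⟨fnTag f, var 1, var 2, var 0⟩, ⟨fnTag g, var 1, var 3, var 0⟩, ⟨1, var 2, var 3, var 4⟩],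
      ⟨fnTag (.pair f g), var 1, var 4, var 0⟩⟩ :: (codeClauses f ++ codeClauses g)
  | .comp f g =>
    ⟨[⟨fnTag g, var 1, var 2, var 0⟩, ⟨fnTag f, var 2, var 3, var 0⟩],
      ⟨fnTag (.comp f g), var 1, var 3, var 0⟩⟩ :: (codeClauses f ++ codeClauses g)
  | .prec f g =>
    unpairClause (.prec f g) ::
    ⟨[⟨fnTag f, var 1, var 2, var 0⟩], ⟨pairFnTag (.prec f g), var 1, var 0, var 2⟩⟩ ::
    ⟨[⟨pairFnTag (.prec f g), var 1, var 2, var 3⟩, ⟨1, var 2, var 3, var 4⟩,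
        ⟨1, var 1, var 4, var 5⟩, ⟨fnTag g, var 5, var 6, var 0⟩],
      ⟨pairFnTag (.prec f g), var 1, .succ 2, var 6⟩⟩ :: (codeClauses f ++ codeClauses g)
  | .rfind' f =>
    unpairClause (.rfind' f) ::
    ⟨[⟨1, var 1, var 2, var 3⟩, ⟨fnTag f, var 3, var 0, var 0⟩],
      ⟨pairFnTag (.rfind' f), var 1, var 2, var 2⟩⟩ ::
    ⟨[⟨1, var 1, var 2, var 3⟩, ⟨fnTag f, var 3, .succ 4, var 0⟩,
        ⟨pairFnTag (.rfind' f), var 1, .succ 2, var 5⟩],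
      ⟨pairFnTag (.rfind' f), var 1, var 2, var 5⟩⟩ :: codeClauses f

end Clauses

def codeProgram (c : Code) : List Clause := succClause :: (arithClauses ++ codeClauses c)

theorem codeClauses_bounded (c : Code) : ∀ cl ∈ codeClauses c, cl.Bounded 7 4 := by
  induction c with
  | pair f g hf hg | comp f g hf hg =>
    simp only [codeClauses, List.forall_mem_cons, List.forall_mem_append]
    refine ⟨?_, hf, hg⟩
    simp [Clause.Bounded, Atm.Bounded, Term.idx]
  | prec f g hf hg =>
    simp only [codeClauses, List.forall_mem_cons, List.forall_mem_append]
    refine ⟨?_, ?_, ?_, hf, hg⟩ <;>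
    simp [Clause.Bounded, Atm.Bounded, Term.idx, unpairClause]
  | rfind' f hf =>
    simp only [codeClauses, List.forall_mem_cons]
    refine ⟨?_, ?_, ?_, hf⟩ <;>
    simp [Clause.Bounded, Atm.Bounded, Term.idx, unpairClause]
  | _ => simp [codeClauses, Clause.Bounded, Atm.Bounded, Term.idx]

theorem codeProgram_bounded (c : Code) : ∀ cl ∈ codeProgram c, cl.Bounded 7 4 := by
  simp only [codeProgram, List.forall_mem_cons, List.forall_mem_append]
  refine ⟨?_, ?_, codeClauses_bounded c⟩ <;>
  simp [arithClauses, Clause.Bounded, Atm.Bounded, Term.idx, succClause]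

/-! ### Soundness of the program -/

/-- The search starts at `m` and returns `k + m` after `k` nonzero values. Writing nonzero values as
successors removes negation, as Horn clauses require. -/
theorem mem_eval_rfind' {f : Code} {a m r : ℕ} : r ∈ (Code.rfind' f).eval (Nat.pair a m) ↔
    ∃ k, k + m = r ∧ 0 ∈ f.eval (Nat.pair a (k + m)) ∧
      ∀ j < k, ∃ y, y + 1 ∈ f.eval (Nat.pair a (j + m)) := by
  have he : (Code.rfind' f).eval (Nat.pair a m) = (Nat.rfind fun n =>
      (f.eval (Nat.pair a (n + m))).map fun k => decide (k = 0)).map (· + m) := by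
    rw [Code.eval, Nat.unpaired, Nat.unpair_pair]; rfl
  have hm : ∀ j b, b ∈ (f.eval (Nat.pair a (j + m))).map (fun k => decide (k = 0)) ↔
      ∃ y ∈ f.eval (Nat.pair a (j + m)), decide (y = 0) = b := fun j b => Part.mem_map_iff _
  rw [he, Part.mem_map_iff]
  refine exists_congr fun k => and_comm.trans (and_congr_right fun _ =>
    Nat.mem_rfind.trans (and_congr ((hm k true).trans (by simp))
      (forall₂_congr fun j _ => (hm j false).trans ⟨?_, ?_⟩)))
  · rintro ⟨_ | y, hy, h0⟩
    · simp at h0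
    · exact ⟨y, hy⟩
  · rintro ⟨y, hy⟩
    exact ⟨y + 1, hy, by simp⟩

theorem unpairClause_sound (c : Code) (v : ℕ → ℕ)
    (h : ∀ p ∈ (unpairClause c).prems, p.IsTrue codeInterp v) :
    (unpairClause c).concl.IsTrue codeInterp v := by
  simp only [unpairClause, Atm.IsTrue, Term.val, List.forall_mem_cons, codeInterp_pairFnTag,
    codeInterp_fnTag, codeInterp_one] at h ⊢
  rw [← h.2.1]; exact h.1

/-- Each clause is an instance of a defining equation of `Code.eval`. -/
theorem codeClauses_sound (c : Code) : ClosedUnder (codeClauses c) codeInterp := by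
  induction c with
  | zero => simp [ClosedUnder, codeClauses, Atm.IsTrue, Term.val, Code.eval, pure, PFun.pure]
  | succ => simp [ClosedUnder, codeClauses, Atm.IsTrue, Term.val, Code.eval]
  | left =>
    simp only [ClosedUnder, codeClauses, List.forall_mem_singleton, Atm.IsTrue, Term.val,
      codeInterp_fnTag, codeInterp_one]
    intro v _ h
    simp [← h, Code.eval]
  | right =>
    simp only [ClosedUnder, codeClauses, List.forall_mem_singleton, Atm.IsTrue, Term.val,
      codeInterp_fnTag, codeInterp_one]
    intro v _ h
    simp [← h, Code.eval]
  | pair f g hf hg =>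
    simp only [ClosedUnder, codeClauses, List.forall_mem_cons, List.forall_mem_append]
    refine ⟨fun v hv h => ?_, hf, hg⟩
    simp only [Atm.IsTrue, Term.val, codeInterp_fnTag, codeInterp_one] at h ⊢
    simp only [Code.eval, Seq.seq, Part.map_eq_map, Part.mem_bind_iff,
      Part.mem_map_iff]
    exact ⟨_, ⟨_, h.1, rfl⟩, _, h.2.1, h.2.2.1⟩
  | comp f g hf hg =>
    simp only [ClosedUnder, codeClauses, List.forall_mem_cons, List.forall_mem_append]
    refine ⟨fun v hv h => ?_, hf, hg⟩
    simp only [Atm.IsTrue, Term.val, codeInterp_fnTag] at h ⊢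
    exact Part.mem_bind_iff.2 ⟨_, h.1, h.2.1⟩
  | prec f g hf hg =>
    simp only [ClosedUnder, codeClauses, List.forall_mem_cons, List.forall_mem_append]
    refine ⟨fun v _ => unpairClause_sound _ v, fun v hv h => ?_, fun v hv h => ?_, hf, hg⟩
    · simp only [Atm.IsTrue, Term.val, codeInterp_fnTag, codeInterp_pairFnTag, hv,
        Code.eval_prec_zero] at h ⊢
      exact h.1
    · simp only [Atm.IsTrue, Term.val, codeInterp_fnTag, codeInterp_pairFnTag, codeInterp_one,
        Code.eval_prec_succ] at h ⊢
      refine Part.mem_bind_iff.2 ⟨_, h.1, ?_⟩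
      rw [h.2.1, h.2.2.1]
      exact h.2.2.2.1
  | rfind' f hf =>
    simp only [ClosedUnder, codeClauses, List.forall_mem_cons]
    refine ⟨fun v _ => unpairClause_sound _ v, fun v hv h => ?_, fun v hv h => ?_, hf⟩
    · simp only [Atm.IsTrue, Term.val, codeInterp_fnTag, codeInterp_pairFnTag, codeInterp_one, hv,
        mem_eval_rfind'] at h ⊢
      refine ⟨0, by simp, ?_, by simp⟩
      rw [Nat.zero_add, h.1]
      exact h.2.1
    · simp only [Atm.IsTrue, Term.val, codeInterp_fnTag, codeInterp_pairFnTag, codeInterp_one,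
        mem_eval_rfind'] at h ⊢
      obtain ⟨h1, h2, ⟨k, hk, h3, h4⟩, -⟩ := h
      -- The search from `m + 1` took `k` steps; the nonzero value at `m` adds one.
      refine ⟨k + 1, by omega, ?_, ?_⟩
      · rwa [add_right_comm, add_assoc]
      · rintro (_ | j) hj
        · exact ⟨_, by rwa [Nat.zero_add, h1]⟩
        · rw [add_right_comm, add_assoc]
          exact h4 j (by omega)

theorem arithClauses_sound : ClosedUnder arithClauses codeInterp := by
  simp only [ClosedUnder, arithClauses, List.forall_mem_cons]
  simp only [Atm.IsTrue, Term.val, codeInterp, List.not_mem_nil]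
  refine ⟨?_, ?_, ?_, ?_, ?_, ?_, ?_, ?_⟩
  · intro v hv _; omega
  · intro v hv h; omega
  · intro v hv _; rw [hv]; rfl
  · rintro v hv ⟨h, h', -⟩
    rw [← h, Nat.pair, Nat.pair, if_pos h', if_pos (by omega)]; omega
  · rintro v hv ⟨h, -⟩
    rw [← h, Nat.pair, Nat.pair, if_neg (by omega), if_pos (by omega), hv]; ring
  · rintro v hv ⟨h, h', -⟩
    rw [← h, Nat.pair, Nat.pair, if_neg (by omega), if_neg (by omega)]; ring
  · rintro v hv ⟨h, -⟩
    rw [← h, Nat.pair, Nat.pair, if_pos (by omega), if_neg (by omega), hv]; ring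
  · simp

theorem codeProgram_sound (c : Code) : ClosedUnder (codeProgram c) codeInterp := by
  simp only [ClosedUnder, codeProgram, List.forall_mem_cons, List.forall_mem_append]
  exact ⟨fun _ _ _ => trivial, arithClauses_sound, codeClauses_sound c⟩

/-! ### Completeness of the program -/

section Completeness

variable {Pr : List Clause}

/-- Valuations are given as lists with `0` put in front, so the requirement on variable `0` holds by
definition. -/
theorem Derivable.of_clause {cl : Clause} (hcl : cl ∈ Pr) (l : List ℕ)
    (h : ∀ p ∈ cl.prems, Derivable Pr p.tag (p.a.val ((0 :: l).getD · 0))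
      (p.b.val ((0 :: l).getD · 0)) (p.c.val ((0 :: l).getD · 0))) :
    Derivable Pr cl.concl.tag (cl.concl.a.val ((0 :: l).getD · 0))
      (cl.concl.b.val ((0 :: l).getD · 0)) (cl.concl.c.val ((0 :: l).getD · 0)) :=
  .rule cl hcl _ rfl h

theorem derivable_lt (hPr : arithClauses ⊆ Pr) {x y : ℕ} (h : x < y) : Derivable Pr 2 x y 0 := by
  induction x generalizing y with
  | zero =>
    obtain ⟨y, rfl⟩ := Nat.exists_eq_succ_of_ne_zero h.ne'
    exact Derivable.of_clause (hPr (.head _)) [y] (by simp)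
  | succ x ih =>
    obtain ⟨y, rfl⟩ := Nat.exists_eq_succ_of_ne_zero (Nat.ne_zero_of_lt h)
    exact Derivable.of_clause (hPr (.tail _ (.head _))) [x, y]
      (by simpa [Term.val] using ih (by omega))

/-- The clauses follow the enumeration of pairs along square shells: below the diagonal value `a <
b` the first component grows until it meets `b`, then the walk goes on at `(b, 0)`; for `b < a` the
second grows, and after `(a, a)` comes `(0, a + 1)`. Soundness of the clauses identifies each new
value as `p + 1`. -/
theorem derivable_unpair (hPr : arithClauses ⊆ Pr) (p : ℕ) :
    Derivable Pr 1 p.unpair.1 p.unpair.2 p := by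
  have hs := arithClauses_sound
  simp only [ClosedUnder, arithClauses, List.forall_mem_cons] at hs
  simp only [Atm.IsTrue, Term.val, codeInterp] at hs
  obtain ⟨-, -, -, h4, h5, h6, h7, -⟩ := hs
  induction p with
  | zero => exact Derivable.of_clause (hPr (.tail _ (.tail _ (.head _)))) [] (by simp)
  | succ p ih =>
    obtain ⟨a, b, hab⟩ : ∃ a b, Nat.pair a b = p := ⟨_, _, Nat.pair_unpair p⟩
    have hu : Nat.unpair p = (a, b) := by rw [← hab, Nat.unpair_pair]
    rw [hu] at ih
    have key : ∀ {x y}, Nat.pair x y = p + 1 → Derivable Pr 1 x y (p + 1) →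
        Derivable Pr 1 (p + 1).unpair.1 (p + 1).unpair.2 (p + 1) := by
      intro x y hxy h
      rw [← hxy, Nat.unpair_pair, hxy]; exact h
    rcases lt_trichotomy a b with h | rfl | h
    · rcases (Nat.succ_le_of_lt h).lt_or_eq with h' | rfl
      · refine key (h4 ([0, a, b, p].getD · 0) rfl (by simpa [hab] using h'))
          (Derivable.of_clause (hPr (.tail _ (.tail _ (.tail _ (.head _))))) [a, b, p] ?_)
        simpa [Term.val] using ⟨ih, derivable_lt hPr h'⟩
      · refine key (h5 ([0, a, a + 1, p].getD · 0) rfl (by simpa using hab))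
          (Derivable.of_clause (hPr (.tail _ (.tail _ (.tail _ (.tail _ (.head _)))))) [a, a + 1, p]
            ?_)
        simpa [Term.val] using ih
    · refine key (h7 ([0, a, a, p].getD · 0) rfl (by simpa using hab))
        (Derivable.of_clause (hPr (.tail _ (.tail _ (.tail _ (.tail _ (.tail _ (.tail _
          (.head _)))))))) [a, a, p] ?_)
      simpa [Term.val] using ih
    · refine key (h6 ([0, a, b, p].getD · 0) rfl (by simpa [hab] using h))
        (Derivable.of_clause (hPr (.tail _ (.tail _ (.tail _ (.tail _ (.tail _ (.head _)))))))
          [a, b, p] ?_)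
      simpa [Term.val] using ⟨ih, derivable_lt hPr h⟩

theorem derivable_pair (hPr : arithClauses ⊆ Pr) (a b : ℕ) : Derivable Pr 1 a b (Nat.pair a b) := by
  simpa using derivable_unpair hPr (Nat.pair a b)

theorem derivable_of_pairFn (hPr : arithClauses ⊆ Pr) {c : Code} (hc : unpairClause c ∈ Pr)
    {x y : ℕ} (h : Derivable Pr (pairFnTag c) x.unpair.1 x.unpair.2 y) :
    Derivable Pr (fnTag c) x y 0 :=
  Derivable.of_clause hc [x.unpair.1, x.unpair.2, y, x]
    (by simpa [unpairClause, Term.val] using ⟨h, derivable_unpair hPr x⟩)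

theorem derivable_of_mem_eval (hPr : arithClauses ⊆ Pr) (c : Code) (hc : codeClauses c ⊆ Pr) :
    ∀ x y, y ∈ c.eval x → Derivable Pr (fnTag c) x y 0 := by
  induction c with
  | zero =>
    intro x y h
    obtain rfl : y = 0 := by simpa [Code.eval, pure, PFun.pure] using h
    exact Derivable.of_clause (hc (.head _)) [x] (by simp)
  | succ =>
    intro x y h
    obtain rfl : y = x + 1 := by simpa [Code.eval] using h
    exact Derivable.of_clause (hc (.head _)) [x] (by simp)
  | left =>
    intro x y h
    obtain rfl : y = x.unpair.1 := by simpa [Code.eval] using h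
    exact Derivable.of_clause (hc (.head _)) [x.unpair.1, x.unpair.2, x]
      (by simpa [Term.val] using derivable_unpair hPr x)
  | right =>
    intro x y h
    obtain rfl : y = x.unpair.2 := by simpa [Code.eval] using h
    exact Derivable.of_clause (hc (.head _)) [x.unpair.1, x.unpair.2, x]
      (by simpa [Term.val] using derivable_unpair hPr x)
  | pair f g hf hg =>
    intro x y h
    rw [codeClauses, List.cons_subset, List.append_subset] at hc
    simp only [Code.eval, Seq.seq, Part.map_eq_map, Part.mem_bind_iff,
      Part.mem_map_iff] at h
    obtain ⟨_, ⟨a, ha, rfl⟩, b, hb, rfl⟩ := h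
    exact Derivable.of_clause hc.1 [x, a, b, Nat.pair a b] (by
      simpa [Term.val] using ⟨hf hc.2.1 _ _ ha, hg hc.2.2 _ _ hb, derivable_pair hPr a b⟩)
  | comp f g hf hg =>
    intro x y h
    rw [codeClauses, List.cons_subset, List.append_subset] at hc
    obtain ⟨a, ha, hb⟩ := Part.mem_bind_iff.1 h
    exact Derivable.of_clause hc.1 [x, a, y] (by
      simpa [Term.val] using ⟨hg hc.2.2 _ _ ha, hf hc.2.1 _ _ hb⟩)
  | prec f g hf hg =>
    intro x y h
    simp only [codeClauses, List.cons_subset, List.append_subset] at hc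
    obtain ⟨hc0, hc1, hc2, hcf, hcg⟩ := hc
    refine derivable_of_pairFn hPr hc0 ?_
    rw [← Nat.pair_unpair x] at h
    generalize x.unpair.1 = a at h ⊢
    generalize x.unpair.2 = n at h ⊢
    -- The recursion runs on the second component of the argument, which is why a separate tag takes
    -- the argument as a pair.
    induction n generalizing y with
    | zero =>
      rw [Code.eval_prec_zero] at h
      exact Derivable.of_clause hc1 [a, y] (by simpa [Term.val] using hf hcf _ _ h)
    | succ n ih =>
      rw [Code.eval_prec_succ] at h
      obtain ⟨i, hi, h⟩ := Part.mem_bind_iff.1 h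
      exact Derivable.of_clause hc2 [a, n, i, Nat.pair n i, Nat.pair a (Nat.pair n i), y] (by
        simpa [Term.val] using
          ⟨ih _ hi, derivable_pair hPr _ _, derivable_pair hPr _ _, hg hcg _ _ h⟩)
  | rfind' f hf =>
    intro x y h
    simp only [codeClauses, List.cons_subset] at hc
    obtain ⟨hc0, hc1, hc2, hcf⟩ := hc
    refine derivable_of_pairFn hPr hc0 ?_
    rw [← Nat.pair_unpair x] at h
    generalize x.unpair.1 = a at h ⊢
    generalize x.unpair.2 = m at h ⊢
    rw [mem_eval_rfind'] at h
    obtain ⟨k, rfl, h, hk⟩ := h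
    -- The induction counts the remaining failed tests, while the starting point `m` moves up.
    induction k generalizing m with
    | zero =>
      rw [Nat.zero_add] at h ⊢
      exact Derivable.of_clause hc1 [a, m, Nat.pair a m] (by
        simpa [Term.val] using ⟨derivable_pair hPr a m, hf hcf _ _ h⟩)
    | succ k ih =>
      obtain ⟨y, hy⟩ := hk 0 (by omega)
      rw [Nat.zero_add] at hy
      rw [add_right_comm, add_assoc] at h ⊢
      refine Derivable.of_clause hc2 [a, m, Nat.pair a m, y, k + (m + 1)] ?_
      have := ih (m + 1) h fun j hj => by
        simpa only [add_right_comm j 1 m, add_assoc] using hk (j + 1) (by omega)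
      simpa [Term.val] using ⟨derivable_pair hPr a m, hf hcf _ _ hy, this⟩

end Completeness

theorem exists_derivable_of_dom {c : Code} {n : ℕ} (h : (c.eval n).Dom) :
    ∃ y, Derivable (codeProgram c) (fnTag c) n y 0 :=
  ⟨_, derivable_of_mem_eval
    (fun _ h => .tail _ (List.mem_append_left _ h)) c
    (fun _ h => .tail _ (List.mem_append_right _ h)) n _ (Part.get_mem h)⟩

/-! ### Computability of the reduction -/

section Computability

variable {F G : ℕ → Body}

theorem primrec_code_neg (hF : Primrec fun n => (F n).code) :
    Primrec fun n => (Body.neg (F n)).code :=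
  Primrec.nat_add.comp (Primrec.nat_mul.comp (.const 5) hF) (.const 1)

theorem primrec_code_or (hF : Primrec fun n => (F n).code) (hG : Primrec fun n => (G n).code) :
    Primrec fun n => (Body.or (F n) (G n)).code :=
  Primrec.nat_add.comp (Primrec.nat_mul.comp (.const 5) (Primrec₂.natPair.comp hF hG)) (.const 2)

theorem primrec_code_and (hF : Primrec fun n => (F n).code) (hG : Primrec fun n => (G n).code) :
    Primrec fun n => ((F n).and (G n)).code :=
  primrec_code_neg (primrec_code_or (primrec_code_neg hF) (primrec_code_neg hG))

theorem primrec_code_iterate_next (φ : Body) : Primrec fun n => (Body.next^[n] φ).code := by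
  have h : ∀ n, (Body.next^[n] φ).code = (fun m => 5 * m + 3)^[n] φ.code := by
    intro n
    induction n with
    | zero => rfl
    | succ n ih => rw [Function.iterate_succ_apply', Function.iterate_succ_apply', ← ih]; rfl
  simp only [h]
  exact Primrec.nat_iterate .id (.const _)
    (Primrec.nat_add.comp (Primrec.nat_mul.comp (.const 5) .snd) (.const 3)).to₂

variable {H : ℕ → HyperLTL}

theorem primrec_code_all (x : ℕ) (hH : Primrec fun n => (H n).code) :
    Primrec fun n => (HyperLTL.all x (H n)).code :=
  Primrec.nat_add.comp (Primrec.nat_mul.comp (.const 3) (Primrec₂.natPair.comp (.const x) hH))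
    (.const 1)

theorem primrec_code_ex (x : ℕ) (hH : Primrec fun n => (H n).code) :
    Primrec fun n => (HyperLTL.ex x (H n)).code :=
  Primrec.nat_add.comp (Primrec.nat_mul.comp (.const 3) (Primrec₂.natPair.comp (.const x) hH))
    (.const 2)

theorem primrec_code_quantified (Pr : List Clause) (V M : ℕ) (hF : Primrec fun n => (F n).code) :
    Primrec fun n => (quantified Pr V M (F n)).code := by
  have halls : ∀ (l : List ℕ) {H : ℕ → HyperLTL}, (Primrec fun n => (H n).code) →
      Primrec fun n => (HyperLTL.alls l (H n)).code := by
    intro l H hH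
    induction l with
    | nil => exact hH
    | cons x l ih => exact primrec_code_all x ih
  have hexs : ∀ (l : List ℕ) {H : ℕ → HyperLTL}, (Primrec fun n => (H n).code) →
      Primrec fun n => (HyperLTL.exs l (H n)).code := by
    intro l H hH
    induction l with
    | nil => exact hH
    | cons x l ih => exact primrec_code_ex x ih
  exact primrec_code_ex 0 (halls _ (hexs _ (Primrec.nat_mul.comp (.const 3) hF)))

/-- The program is fixed; `n` enters only as the number of iterated next operators in the goal. -/
theorem primrec_hornFormula (Pr : List Clause) (V M g : ℕ) : Primrec (hornFormula Pr V M g) :=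
  Primrec.encode_iff.1 (primrec_code_quantified Pr V M (primrec_code_and (.const _)
    (primrec_code_neg (primrec_code_and (.const _) (primrec_code_iterate_next _)))))

end Computability

/-! ### Undecidability -/

theorem isKSafety_empty {α : Type} (k : ℕ) : IsKSafety k (∅ : Hyperproperty α) := by
  have h : ∀ T : Set (Trace α), SetPrefix ∅ T ∧ IsBadPrefix (∅ : Hyperproperty α) ∅ :=
    fun T => ⟨fun u hu => hu.elim, fun _ _ hT => hT⟩
  exact ⟨fun T _ => ⟨∅, Set.finite_empty, h T⟩, fun T _ => ⟨∅, by simp, h T⟩⟩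

theorem IsSafety.isWeakSafety {α : Type} {S : Hyperproperty α} (h : IsSafety S) :
    IsWeakSafety S := fun T hT => let ⟨U, _, hU⟩ := h T hT; ⟨U, hU⟩

/-- A bad prefix of `T` is also below any larger set, so a violating set cannot be contained in a
member. -/
theorem not_isWeakSafety {α : Type} {S : Hyperproperty α} {T T' : Set (Trace α)} (hT : T ∉ S)
    (hT' : T' ∈ S) (h : T ⊆ T') : ¬ IsWeakSafety S := fun hS =>
  let ⟨_, hU, hbad⟩ := hS T hT
  hbad T' (fun u hu => let ⟨t, ht, hut⟩ := hU u hu; ⟨t, h ht, hut⟩) hT'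

/-- The sentence that is unsatisfiable if and only if the evaluation of `c` at `n` terminates. -/
def haltFormula (c : Code) (n : ℕ) : HyperLTL := hornFormula (codeProgram c) 7 4 (fnTag c) n

theorem lang_haltFormula_of_dom {c : Code} {n : ℕ} (h : (c.eval n).Dom) (A : Set ℕ) :
    (haltFormula c n).lang A = ∅ := by
  obtain ⟨y, hy⟩ := exists_derivable_of_dom h
  refine Set.eq_empty_of_forall_notMem fun T hT => ?_
  exact not_derivable_of_sat (by omega) (by omega) (codeProgram_bounded c) (.head _) hT y 0 hy

theorem not_isWeakSafety_haltFormula {c : Code} {n : ℕ} (h : ¬ (c.eval n).Dom) {A : Set ℕ}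
    (hA : (haltFormula c n).props ⊆ A) : ¬ IsWeakSafety ((haltFormula c n).lang A) := by
  have hs : (haltFormula c n).Sat (modelTraces codeInterp) (fun _ => none) :=
    sat_modelTraces (by omega) (by omega) (codeProgram_bounded c) (codeProgram_sound c) trivial
      fun y z hy => h (Part.dom_iff_mem.2 ⟨y, (codeInterp_fnTag c n y z).1 hy⟩)
  -- The model over all propositions is carried to `A`; the blank trace restricts to the blank
  -- trace.
  rw [← HyperLTL.sat_restrict _ _ hA] at hs
  refine not_isWeakSafety (T := {blankTrace A}) (not_sat_singleton_blank (by omega) _ n) hs ?_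
  rw [Set.singleton_subset_iff]
  exact ⟨blankTrace _, Or.inl rfl, rfl⟩

/-- A single universal code keeps the Horn program and the quantifier prefix fixed, so the reduction
has to compute only a number. -/
theorem exists_code_halting :
    ∃ u : Code, ∀ c : Code, (u.eval (Encodable.encode c)).Dom ↔ (c.eval 0).Dom := by
  have hf : Partrec fun n : ℕ => (Denumerable.ofNat Code n).eval 0 :=
    Code.eval_part.comp (Computable.ofNat Code) (.const 0)
  obtain ⟨u, hu⟩ := Code.exists_code.1 (Partrec.nat_iff.1 hf)
  exact ⟨u, fun c => by
    have h : u.eval (Encodable.encode c) =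
      (Denumerable.ofNat Code (Encodable.encode c)).eval 0 := congrFun hu _
    rw [h, Denumerable.ofNat_encode]⟩

theorem not_decidableOnSentences {p : HyperLTL → Prop} {u : Code}
    (hu : ∀ c : Code, (u.eval (Encodable.encode c)).Dom ↔ (c.eval 0).Dom)
    (hp : ∀ n, p (haltFormula u n) ↔ (u.eval n).Dom) : ¬ DecidableOnSentences p := by
  rintro ⟨q, hq, hqp⟩
  refine ComputablePred.halting_problem 0
    (ComputablePred.computable_of_manyOneReducible (q := q)
      ⟨fun c => haltFormula u (Encodable.encode c), ?_, fun c => ?_⟩ hq)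
  · exact (primrec_hornFormula _ _ _ _).to_comp.comp Computable.encode
  · have hs := hornFormula_isSentence (by omega) (by omega) (codeProgram_bounded u) (fnTag u)
      (Encodable.encode c)
    exact (((hqp _ hs).trans (hp _)).trans (hu c)).symm

end Hyper

theorem mainTheorem11 (AP : Hyper.HyperLTL → Set ℕ)
    (hAP : ∀ φ : Hyper.HyperLTL, φ.props ⊆ AP φ) :
    (∀ k : ℕ, ¬ Hyper.DecidableOnSentences (fun φ => Hyper.IsKSafety k (φ.lang (AP φ)))) ∧
    (¬ Hyper.DecidableOnSentences (fun φ => ∃ k : ℕ, Hyper.IsKSafety k (φ.lang (AP φ)))) ∧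
    (¬ Hyper.DecidableOnSentences (fun φ => Hyper.IsSafety (φ.lang (AP φ)))) ∧
    (¬ Hyper.DecidableOnSentences (fun φ => Hyper.IsWeakSafety (φ.lang (AP φ)))) := by
  obtain ⟨u, hu⟩ := Hyper.exists_code_halting
  -- Halting gives the strongest notion for every `k` and divergence refutes the weakest, so all
  -- four properties coincide with halting on these sentences.
  have hK : ∀ n k, (u.eval n).Dom →
      Hyper.IsKSafety k ((Hyper.haltFormula u n).lang (AP (Hyper.haltFormula u n))) := by
    intro n k h
    rw [Hyper.lang_haltFormula_of_dom h]
    exact Hyper.isKSafety_empty k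
  have hW : ∀ n, Hyper.IsWeakSafety ((Hyper.haltFormula u n).lang (AP (Hyper.haltFormula u n))) →
      (u.eval n).Dom := fun n h => by
    by_contra hn
    exact Hyper.not_isWeakSafety_haltFormula hn (hAP _) h
  exact ⟨fun k => Hyper.not_decidableOnSentences hu fun n =>
      ⟨fun h => hW n h.1.isWeakSafety, hK n k⟩,
    Hyper.not_decidableOnSentences hu fun n =>
      ⟨fun ⟨_, h⟩ => hW n h.1.isWeakSafety, fun h => ⟨0, hK n 0 h⟩⟩,
    Hyper.not_decidableOnSentences hu fun n =>
      ⟨fun h => hW n h.isWeakSafety, fun h => (hK n 0 h).1⟩,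
    Hyper.not_decidableOnSentences hu fun n =>
      ⟨hW n, fun h => (hK n 0 h).1.isWeakSafety⟩⟩
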